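/- Let $\mathcal N=(\mathcal P_v)_{v\in V}$ be an abelian network on a directed graph $G=(V,E)$ (loops allowed): each $\mathcal P_v$ has an input alphabet $A_v$, a state space $Q_v$, commuting transition maps $t_a:Q_v\to Q_v$ ($a\in A_v$), and message passing functions $o_a^u:Q_v\to A_u^*$ for $a\in A_v$, $(v,u)\in E$, such that input words equal up to permutation, read in the same initial state, produce output words equal up to permutation on each edge. Put $A=\bigsqcup_v A_v$ and $Q=\prod_v Q_v$. Assume that $\mathcal N$ is * finite: $V$, all $A_v$ and all $Q_v$ are finite; * irreducible: for each $v$, $Q_v\neq\emptyset$ and for all $q,q'\in Q_v$ there are $m,m'$ in the local monoid $M_v=\langle t_a\rangle_{a\in A_v}\subset \mathrm{End}(Q_v)$ with $mq=m'q'$; * halting on all inputs: for all $\mathbf x\in\mathbb N^A$, $\mathbf q\in Q$ there is a finite complete legal execution for $\mathbf x.\mathbf q$, i.e. a sequence of letters that can be processed one after the other, each being present among the waiting letters when it is processed, after which no letter is waiting. Write $\mathbf x\triangleright\triangleright\mathbf q$ for the state of the network after a complete legal execution for $\mathbf x.\mathbf q$ (it does not depend on the execution), let $\tau_a(\mathbf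 q)=1_a\triangleright\triangleright\mathbf q$, and let $M=\langle\tau_a\rangle_{a\in A}\subset\mathrm{End}(Q)$, a finite commutative monoid. The minimal idempotent of a finite commutative monoid is the product of all its idempotents. Let $e$ be that of $M$ and $e_v$ that of $M_v$. Let $\mathrm{Crit}\,\mathcal N=eM$ be the critical group and $\mathrm{Rec}\,\mathcal N=\{\mathbf q\in Q: e\mathbf q=\mathbf q\}$ the set of recurrent states. The maps $t_a$, $a\in A_v$, are commuting permutations of $e_vQ_v$; let $K_v$ be the kernel of the resulting action of $\mathbb Z^{A_v}$ on $e_vQ_v$, and let $K=\prod_v K_v\subset\mathbb Z^A$ be the total kernel. For $a\in A$ let $r_a=\min\{m\ge1: m1_a\in K\}$, and let $D$ be the diagonal $A\times A$ matrix with entries $r_a$. A state $\mathbf q\in Q$ is locally recurrent if $\mathbf q_v\in e_vQ_v$ for all $v$. For such $\mathbf q$ and $\mathbf k\in K\cap\mathbb N^A$, processing exactly $\mathbf k_a$ letters $a$ for each $a\in A$ in state $\mathbf q$ returns the network to $\mathbf q$; let $P(\mathbf k)\in\mathbb N^A$ count the letters of each type passed. The production matrix $P$ is the rational $A\times A$ matrix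 whose column $a$ is $P(1_a)=\frac1{r_a}P(r_a1_a)$; it is the same for all locally recurrent $\mathbf q$. Let $L=(I-P)D$ be the Laplacian and $\iota=[K:D\mathbb Z^A]$ the index of $D\mathbb Z^A$ in $K$. Then $$\#\mathrm{Rec}\,\mathcal N=\#\mathrm{Crit}\,\mathcal N=\frac{\det L}{\iota}.$$ -/

import Mathlib

noncomputable section

/-! ### Monoids of self-maps of a finite set -/

namespace EndAction

instance instFiniteEnd {X : Type*} [Finite X] : Finite (Function.End X) :=
  inferInstanceAs (Finite (X → X))

/-- The action of the monoid `M` of self-maps of `X` is irreducible: the relation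
`x ∼ y ↔ ∃ m m' ∈ M, m x = m' y` has exactly one equivalence class. -/
def IsIrreducible {X : Type*} (M : Submonoid (Function.End X)) : Prop :=
  Nonempty X ∧ ∀ x y : X, ∃ m ∈ M, ∃ m' ∈ M, m • x = m' • y

/-- The minimal idempotent `e = ∏ f`, the product of all idempotents `f` of `M`. The order of the
factors is irrelevant when `M` is commutative, which is the only case of interest. -/
def minIdem {X : Type*} [Finite X] (M : Submonoid (Function.End X)) : Function.End X :=
  (Set.toFinite {f : Function.End X | f ∈ M ∧ f * f = f}).toFinset.toList.prod

/-- The set `e X = {x | e x = x}`, where `e` is the minimal idempotent. -/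
def recurrentSet {X : Type*} [Finite X] (M : Submonoid (Function.End X)) : Set X :=
  {x | minIdem M • x = x}

/-- The set `e M`, where `e` is the minimal idempotent. -/
def minIdeal {X : Type*} [Finite X] (M : Submonoid (Function.End X)) : Set (Function.End X) :=
  {g | ∃ m ∈ M, g = minIdem M * m}

theorem exists_pow_idem {G : Type*} [Monoid G] [Finite G] (m : G) :
    ∃ j : ℕ, m ^ (j + 1) * m ^ (j + 1) = m ^ (j + 1) := by
  obtain ⟨a, b, hab, h⟩ := Finite.exists_ne_map_eq_of_infinite (fun n : ℕ => m ^ (n + 1))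
  wlog hlt : a < b generalizing a b
  · exact this b a hab.symm h.symm (by omega)
  obtain ⟨d, rfl⟩ := Nat.exists_eq_add_of_lt hlt
  have key : ∀ k i : ℕ, m ^ (a + 1 + i) = m ^ (a + 1 + i + k * (d + 1)) := by
    intro k
    induction k with
    | zero => simp
    | succ k ih =>
      intro i
      rw [ih i]
      have h' : m ^ (a + 1) = m ^ (a + 1 + (d + 1)) := by
        simpa [add_assoc, add_comm, add_left_comm] using h
      rw [show a + 1 + i + k * (d + 1) = (a + 1) + (i + k * (d + 1)) by ring, pow_add, h',
        ← pow_add]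
      congr 1
      ring
  refine ⟨(a + 1) * (d + 1) - 1, ?_⟩
  have h1 : (a + 1) * (d + 1) - 1 + 1 = (a + 1) + (a + 1) * d := by
    have : (a + 1) * (d + 1) = (a + 1) + (a + 1) * d := by ring
    omega
  rw [← pow_add, h1]
  have := key (a + 1) ((a + 1) * d)
  rw [this]
  congr 1
  ring

variable {X : Type*} [Finite X] {M : Submonoid (Function.End X)}

theorem minIdem_mem : minIdem M ∈ M :=
  M.list_prod_mem fun f hf => by
    simp only [Finset.mem_toList, Set.Finite.mem_toFinset, Set.mem_ofPred_eq] at hf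
    exact hf.1

theorem list_prod_idem {G : Type*} [Monoid G] (l : List G)
    (hc : ∀ f ∈ l, ∀ g ∈ l, f * g = g * f) (hi : ∀ f ∈ l, f * f = f) :
    l.prod * l.prod = l.prod ∧ ∀ f ∈ l, l.prod * f = l.prod := by
  induction l with
  | nil => simp
  | cons a l ih =>
    have ih' := ih (fun f hf g hg => hc f (by simp [hf]) g (by simp [hg]))
      (fun f hf => hi f (by simp [hf]))
    have hal : Commute a l.prod := by
      apply Commute.list_prod_right
      intro g hg
      exact hc a (by simp) g (by simp [hg])
    have ha := hi a (by simp)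
    refine ⟨?_, ?_⟩
    · rw [List.prod_cons, hal.symm.mul_mul_mul_comm, ha, ih'.1]
    · intro f hf
      rw [List.prod_cons]
      rcases List.mem_cons.1 hf with rfl | hf
      · rw [mul_assoc, ← hal.eq, ← mul_assoc, ha]
      · rw [mul_assoc, ih'.2 f hf]

/-- In a finite commutative monoid `e` is an idempotent accessible from every element. -/
theorem minIdem_spec (hc : ∀ f ∈ M, ∀ g ∈ M, f * g = g * f) :
    minIdem M * minIdem M = minIdem M ∧
      ∀ m ∈ M, ∃ m' ∈ M, m' * m = minIdem M := by
  have h := list_prod_idem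
    (Set.toFinite {f : Function.End X | f ∈ M ∧ f * f = f}).toFinset.toList
    (fun f hf g hg => by
      simp only [Finset.mem_toList, Set.Finite.mem_toFinset, Set.mem_ofPred_eq] at hf hg
      exact hc f hf.1 g hg.1)
    (fun f hf => by
      simp only [Finset.mem_toList, Set.Finite.mem_toFinset, Set.mem_ofPred_eq] at hf
      exact hf.2)
  refine ⟨h.1, fun m hm => ?_⟩
  obtain ⟨j, hj⟩ := exists_pow_idem m
  refine ⟨minIdem M * m ^ j, M.mul_mem minIdem_mem (M.pow_mem hm j), ?_⟩
  rw [mul_assoc, ← pow_succ]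
  exact h.2 _ (by
    simp only [Finset.mem_toList, Set.Finite.mem_toFinset, Set.mem_ofPred_eq]
    exact ⟨M.pow_mem hm _, hj⟩)

end EndAction

/-! ### Abelian processors -/

/-- The output word that results from processing the input word `w` in state `q`. -/
def outputWord {I Q B : Type*} (t : I → Function.End Q) (o : I → Q → List B) :
    List I → Q → List B
  | [], _ => []
  | a :: w, q => o a q ++ outputWord t o w (t a • q)

/-- An abelian processor with input alphabet `I`, state space `Q` and output alphabets
`(B u)_{u ∈ U}`. -/
structure AbelianProcessor (I Q : Type*) {U : Type*} (B : U → Type*) where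
  /-- the state transitions -/
  t : I → Function.End Q
  /-- the message passing functions -/
  o : I → (u : U) → Q → List (B u)
  t_comm : ∀ a b : I, t a * t b = t b * t a
  o_perm : ∀ (q : Q) (w w' : List I), w.Perm w' → ∀ u : U,
    (outputWord t (fun a => o a u) w q).Perm (outputWord t (fun a => o a u) w' q)

namespace AbelianProcessor

open EndAction

variable {I Q U : Type*} {B : U → Type*} (p : AbelianProcessor I Q B)

/-- The transition monoid `⟨t_a⟩`. -/
def monoid : Submonoid (Function.End Q) := Submonoid.closure (Set.range p.t)

theorem monoid_comm : ∀ f ∈ p.monoid, ∀ g ∈ p.monoid, f * g = g * f := by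
  have h : ∀ x ∈ Set.range p.t, ∀ y ∈ Set.range p.t, x * y = y * x := by
    rintro _ ⟨a, rfl⟩ _ ⟨b, rfl⟩
    exact p.t_comm a b
  intro f hf g hg
  have := (Submonoid.isMulCommutative_closure _ h).is_comm.comm ⟨f, hf⟩ ⟨g, hg⟩
  exact congrArg Subtype.val this

theorem t_mem (a : I) : p.t a ∈ p.monoid := Submonoid.subset_closure ⟨a, rfl⟩

variable [Finite Q]

theorem t_smul_mem (a : I) (q : recurrentSet p.monoid) :
    p.t a • (q : Q) ∈ recurrentSet p.monoid := by
  have hq : minIdem p.monoid • (q : Q) = q := q.2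
  change minIdem p.monoid • (p.t a • (q : Q)) = p.t a • (q : Q)
  rw [← mul_smul, p.monoid_comm _ minIdem_mem _ (p.t_mem a), mul_smul, hq]

theorem t_bijective (a : I) : Function.Bijective
    (fun q : recurrentSet p.monoid =>
      (⟨p.t a • (q : Q), p.t_smul_mem a q⟩ : recurrentSet p.monoid)) := by
  rw [← Finite.injective_iff_bijective]
  intro q q' h
  have h' : p.t a • (q : Q) = p.t a • (q' : Q) := congrArg Subtype.val h
  obtain ⟨m, -, hm⟩ := (minIdem_spec p.monoid_comm).2 _ (p.t_mem a)
  have hq : minIdem p.monoid • (q : Q) = q := q.2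
  have hq' : minIdem p.monoid • (q' : Q) = q' := q'.2
  apply Subtype.ext
  rw [← hq, ← hq', ← hm, mul_smul, mul_smul, h']

/-- The permutation of `e Q` given by `t_a`. -/
def perm (a : I) : Equiv.Perm (recurrentSet p.monoid) := Equiv.ofBijective _ (p.t_bijective a)

theorem perm_commute (a b : I) : Commute (p.perm a) (p.perm b) := by
  ext q
  change p.t a • (p.t b • (q : Q)) = p.t b • (p.t a • (q : Q))
  rw [← mul_smul, p.t_comm, mul_smul]

/-- The action of the group `ℤ^I` on `e Q` in which the basis vector `1_a` acts by `t_a`. -/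
def intAction [Fintype I] : (I → ℤ) →+ Additive (Equiv.Perm (recurrentSet p.monoid)) :=
  AddMonoidHom.noncommPiCoprod
    (fun a => zmultiplesHom (Additive (Equiv.Perm (recurrentSet p.monoid)))
      (Additive.ofMul (p.perm a)))
    (fun a b _ m n => by
      have h : AddCommute (Additive.ofMul (p.perm a)) (Additive.ofMul (p.perm b)) :=
        congrArg Additive.ofMul (p.perm_commute a b)
      exact (h.zsmul_left m).zsmul_right n)

/-- The kernel of the action of `ℤ^I` on `e Q`. -/
def kernel [Fintype I] : AddSubgroup (I → ℤ) := p.intAction.ker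

end AbelianProcessor

/-! ### Abelian networks -/

/-- An abelian network on the directed graph `G` with alphabets `A v` and state spaces `Q v`: at
each vertex `v` an abelian processor with one output alphabet `A u` for each edge `(v, u)`. -/
structure AbelianNetwork {V : Type*} (G : Digraph V) (A Q : V → Type*) where
  proc : (v : V) → AbelianProcessor (A v) (Q v) (fun u : {u : V // G.Adj v u} => A u)

namespace AbelianNetwork

open EndAction

/-- The total alphabet `A = ⊔ A_v`. -/
abbrev Letter {V : Type*} (A : V → Type*) := Σ v, A v

/-- A pair `x.q`, consisting of `x ∈ ℤ^A` and a state `q ∈ ∏ Q_v`. -/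
abbrev Config {V : Type*} (A Q : V → Type*) := (Letter A → ℤ) × ((v : V) → Q v)

variable {V : Type*} {G : Digraph V} {A Q : V → Type*}
variable [DecidableEq V] [∀ v, DecidableEq (A v)]
variable (N : AbelianNetwork G A Q)

open Classical in
/-- The number of letters `b` that are sent when the letter `a` is processed in state `q`. -/
def sent (a : Letter A) (q : (v : V) → Q v) (b : Letter A) : ℕ :=
  if h : G.Adj a.1 b.1 then ((N.proc a.1).o a.2 ⟨b.1, h⟩ (q a.1)).count b.2 else 0

/-- Process the letter `a`. -/
def step (c : Config A Q) (a : Letter A) : Config A Q :=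
  (fun b => c.1 b - (if b = a then 1 else 0) + (N.sent a c.2 b : ℤ),
    Function.update c.2 a.1 ((N.proc a.1).t a.2 • c.2 a.1))

/-- The result `π_w(x.q)` of the execution `w`. -/
def exec (w : List (Letter A)) (c : Config A Q) : Config A Q := w.foldl N.step c

/-- The execution `w` is legal for `x.q`. -/
def Legal : List (Letter A) → Config A Q → Prop
  | [], _ => True
  | a :: w, c => 1 ≤ c.1 a ∧ Legal w (N.step c a)

/-- The execution `w` is complete for `x.q`. -/
def Complete (w : List (Letter A)) (c : Config A Q) : Prop := ∀ a, (N.exec w c).1 a ≤ 0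

/-- The network halts on input `x.q`. -/
def HaltsOn (c : Config A Q) : Prop := ∃ w, N.Legal w c ∧ N.Complete w c

/-- The pair `x.q` for `x ∈ ℕ^A`. -/
def input (x : Letter A → ℕ) (q : (v : V) → Q v) : Config A Q := (fun a => (x a : ℤ), q)

/-- The network halts on all inputs. -/
def HaltsOnAllInputs : Prop := ∀ (x : Letter A → ℕ) (q : (v : V) → Q v), N.HaltsOn (input x q)

open Classical in
/-- The final state `x ▷▷ q` of a complete legal execution for `x.q` (if there is no such execution,
the value is `q`). -/
def globalAct (x : Letter A → ℕ) (q : (v : V) → Q v) : (v : V) → Q v :=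
  if h : N.HaltsOn (input x q) then (N.exec h.choose (input x q)).2 else q

/-- The map `τ_a : q ↦ 1_a ▷▷ q`. -/
def tau (a : Letter A) : Function.End ((v : V) → Q v) := fun q => N.globalAct (Pi.single a 1) q

/-- The global monoid `M = ⟨τ_a⟩`. -/
def globalMonoid : Submonoid (Function.End ((v : V) → Q v)) :=
  Submonoid.closure (Set.range N.tau)

/-- The network is irreducible: each of its processors is. -/
def IsIrreducible : Prop := ∀ v, EndAction.IsIrreducible (N.proc v).monoid

variable [Fintype V] [∀ v, Fintype (A v)] [∀ v, Finite (Q v)]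

/-- The set `Crit N = e M` underlying the critical group. -/
def Crit : Set (Function.End ((v : V) → Q v)) := minIdeal N.globalMonoid

/-- The set `Rec N` of recurrent states, those with `q = e q`. -/
def Rec : Set ((v : V) → Q v) := recurrentSet N.globalMonoid

/-- The state `q` is locally recurrent: `q_v ∈ e_v Q_v` for all `v`. -/
def IsLocallyRecurrent (q : (v : V) → Q v) : Prop :=
  ∀ v, q v ∈ recurrentSet (N.proc v).monoid

/-- An irreducible network has a locally recurrent state. -/
theorem exists_isLocallyRecurrent (h : N.IsIrreducible) : ∃ q, N.IsLocallyRecurrent q := by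
  refine ⟨fun v => minIdem (N.proc v).monoid • (h v).1.some, fun v => ?_⟩
  change minIdem (N.proc v).monoid • (minIdem (N.proc v).monoid • _) = _
  rw [← mul_smul, (minIdem_spec (N.proc v).monoid_comm).1]

/-- The restriction `ℤ^A → ℤ^{A_v}`. -/
def restrict (A : V → Type*) (v : V) : (Letter A → ℤ) →+ (A v → ℤ) where
  toFun x a := x ⟨v, a⟩
  map_zero' := rfl
  map_add' _ _ := rfl

/-- The total kernel `K = ∏ K_v`. -/
def totalKernel : AddSubgroup (Letter A → ℤ) :=
  ⨅ v, (N.proc v).kernel.comap (restrict A v)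

/-- A word in which each letter `a` occurs `x a` times. -/
def wordOf (x : Letter A → ℕ) : List (Letter A) :=
  Finset.univ.toList.flatMap fun a => List.replicate (x a) a

/-- The local action `x ▷ q = π_x(x.q)`. -/
def localAct (x : Letter A → ℕ) (q : (v : V) → Q v) : Config A Q := N.exec (wordOf x) (input x q)

/-- The production `P_q(k)`, where `k ▷ q = P_q(k).q` for `k ∈ K ∩ ℕ^A` and `q` locally
recurrent. -/
def production (q : (v : V) → Q v) (k : Letter A → ℕ) : Letter A → ℤ := (N.localAct k q).1

/-- The reset number `r_a = min {m ≥ 1 : m 1_a ∈ K}`. -/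
def resetNumber (a : Letter A) : ℕ := sInf {m : ℕ | 1 ≤ m ∧ Pi.single a (m : ℤ) ∈ N.totalKernel}

theorem resetNumber_spec (a : Letter A) :
    1 ≤ N.resetNumber a ∧ Pi.single a (N.resetNumber a : ℤ) ∈ N.totalKernel := by
  refine Nat.sInf_mem (s := {m : ℕ | 1 ≤ m ∧ Pi.single a (m : ℤ) ∈ N.totalKernel}) ?_
  let F : V → Type _ := fun v => Equiv.Perm (recurrentSet (N.proc v).monoid)
  refine ⟨∏ v, Nat.card (F v), Finset.prod_pos fun v _ => Nat.card_pos, ?_⟩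
  have hs : Pi.single a ((∏ v, Nat.card (F v) : ℕ) : ℤ) =
      (∏ v, Nat.card (F v)) • (Pi.single a 1 : Letter A → ℤ) := by
    rw [← Pi.single_smul]
    simp
  rw [hs]
  refine (AddSubgroup.mem_iInf).2 fun v => ?_
  rw [AddSubgroup.mem_comap, map_nsmul]
  change (N.proc v).intAction _ = 0
  rw [map_nsmul]
  obtain ⟨d, hd⟩ := Finset.dvd_prod_of_mem (fun v => Nat.card (F v)) (Finset.mem_univ v)
  rw [hd, mul_comm, mul_nsmul']
  have : Nat.card (F v) = Nat.card (Additive (F v)) := rfl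
  rw [this, card_nsmul_eq_zero', nsmul_zero]

/-- The production matrix: the column of the letter `a` is
`P_q(1_a) = (1 / r_a) P_q(r_a 1_a)`. -/
def productionMatrix (q : (v : V) → Q v) : Matrix (Letter A) (Letter A) ℚ :=
  Matrix.of fun b a =>
    (1 / (N.resetNumber a : ℚ)) * (N.production q (Pi.single a (N.resetNumber a)) b : ℚ)

/-- The Laplacian `L = (I - P) D`. -/
def laplacian (q : (v : V) → Q v) : Matrix (Letter A) (Letter A) ℚ :=
  (1 - N.productionMatrix q) * Matrix.diagonal fun a => (N.resetNumber a : ℚ)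

/-- The rectangular lattice `D ℤ^A`. -/
def rectLattice : AddSubgroup (Letter A → ℤ) :=
  (LinearMap.range (Matrix.mulVecLin
    (Matrix.diagonal fun a : Letter A => (N.resetNumber a : ℤ)))).toAddSubgroup

/-- The index `ι = [K : D ℤ^A]`. -/
def iota : ℕ := N.rectLattice.relIndex N.totalKernel

end AbelianNetwork

end

/-!
A group element of `ℤ^A` fixing one recurrent state fixes all of them, so `Rec N` is a torsor for
`ℤ^A / Λ`, where `Λ` is the kernel of the action of `ℤ^A` on `Rec N`, and `#Rec N = [ℤ^A : Λ]`.
Executing `k ∈ K` at a locally recurrent state trades `k` for `P k`, so `(I - P) K ⊆ Λ`; conversely,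
if two inputs stabilize to the same state, then the difference of their odometers (the letter counts
of complete legal executions) lies in `K` and is mapped by `I - P` to the difference of the inputs.
Hence `I - P` maps `K` onto `Λ`, and the chain `ℤ^A → K → ℤ^A` of `D` and `I - P`, whose composite
is `L`, gives `|det L| = ι [ℤ^A : Λ]`.

The determinant is positive because `L` has nonpositive off-diagonal entries and `L c > 0` for some
`c ≥ 0`: rounding the odometer `x` of the input `r` down to `D c` leaves the remainder
`x - D c < r` in each coordinate, and processing a remainder `y` loses at most `y` letters.
-/

section NatVectors

variable {I : Type*}

/-- The inclusion `ℕ^I → ℤ^I`. -/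
def castVec : (I → ℕ) →+ (I → ℤ) := (Nat.castAddMonoidHom ℤ).compLeft I

@[simp]
theorem castVec_apply (x : I → ℕ) (a : I) : castVec x a = x a := rfl

theorem castVec_injective : Function.Injective (castVec (I := I)) :=
  fun _ _ h => funext fun a => Int.ofNat_inj.1 (congrFun h a)

theorem castVec_nonneg (x : I → ℕ) : 0 ≤ castVec x := fun a => Int.natCast_nonneg (x a)

theorem castVec_single [DecidableEq I] (a : I) (n : ℕ) :
    castVec (Pi.single a n) = Pi.single a (n : ℤ) :=
  (Pi.single_op (fun _ => Nat.castAddMonoidHom ℤ) (fun _ => rfl) a n).symm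

/-- The truncation `k ↦ max k 0`, with values in `ℕ^I`. It serves to write vectors of `ℤ^I` as
differences of vectors of `ℕ^I`. -/
def natPart (k : I → ℤ) : I → ℕ := fun a => (k a).toNat

theorem castVec_natPart {k : I → ℤ} (hk : 0 ≤ k) : castVec (natPart k) = k :=
  funext fun a => Int.toNat_of_nonneg (hk a)

theorem castVec_natPart_sub (k : I → ℤ) : castVec (natPart k) - castVec (natPart (-k)) = k :=
  funext fun a => Int.toNat_sub_toNat_neg (k a)

@[elab_as_elim]
theorem natVec_induction [Finite I] [DecidableEq I] {P : (I → ℕ) → Prop} (x : I → ℕ)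
    (zero : P 0) (add_single : ∀ x a, P x → P (x + Pi.single a 1)) : P x := by
  suffices h : ∀ y, P y → P (y + x) by simpa only [zero_add] using h 0 zero
  induction x using Pi.single_induction with
  | zero => exact fun y hy => hy
  | add f g hf hg => exact fun y hy => add_assoc y f g ▸ hg _ (hf y hy)
  | single a n =>
    induction n with
    | zero => exact fun y hy => by simpa only [Pi.single_zero, add_zero] using hy
    | succ n ih =>
      intro y hy
      rw [Pi.single_add, ← add_assoc]
      exact add_single _ a (ih y hy)

end NatVectors

/-! ### Determinants and lattice indices -/

section Determinants

open Matrix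

variable {n : Type*} [Fintype n] [DecidableEq n]

theorem det_pos_of_sum_row_lt_diag {M : Matrix n n ℝ}
    (hM : ∀ k, ∑ j ∈ Finset.univ.erase k, |M k j| < M k k) : 0 < M.det := by
  -- The segment from the identity to `M` consists of diagonally dominant matrices.
  let f : ℝ → ℝ := fun t => ((1 - t) • (1 : Matrix n n ℝ) + t • M).det
  have hf_ne : ∀ t ∈ Set.Icc (0 : ℝ) 1, f t ≠ 0 := by
    rintro t ⟨ht0, ht1⟩
    refine det_ne_zero_of_sum_row_lt_diag fun k => ?_
    have hoff : ∑ j ∈ Finset.univ.erase k, ‖((1 - t) • (1 : Matrix n n ℝ) + t • M) k j‖ =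
        t * ∑ j ∈ Finset.univ.erase k, |M k j| := by
      rw [Finset.mul_sum]
      refine Finset.sum_congr rfl fun j hj => ?_
      simp [(Finset.ne_of_mem_erase hj).symm, abs_of_nonneg ht0]
    have hdiag : ((1 - t) • (1 : Matrix n n ℝ) + t • M) k k = (1 - t) + t * M k k := by simp
    have hpos : 0 ≤ ∑ j ∈ Finset.univ.erase k, |M k j| :=
      Finset.sum_nonneg fun _ _ => abs_nonneg _
    rw [hoff, hdiag, Real.norm_eq_abs]
    refine lt_of_lt_of_le ?_ (le_abs_self _)
    rcases ht0.eq_or_lt with rfl | ht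
    · simp
    · nlinarith [hM k, hpos]
  have hf_cont : Continuous f := by fun_prop
  have hf_zero : f 0 = 1 := by simp [f]
  have hf_one : f 1 = M.det := by simp [f]
  by_contra! hle
  obtain ⟨t, ht, hft⟩ := intermediate_value_Icc' zero_le_one hf_cont.continuousOn
    (show (0 : ℝ) ∈ Set.Icc (f 1) (f 0) from ⟨hf_one ▸ hle, hf_zero ▸ zero_le_one⟩)
  exact hf_ne t ht hft

theorem det_pos_of_mulVec_pos {M : Matrix n n ℝ} (hM : ∀ i j, i ≠ j → M i j ≤ 0) {c : n → ℝ}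
    (hc : ∀ i, 0 ≤ c i) (hMc : ∀ i, 0 < (M *ᵥ c) i) : 0 < M.det := by
  have hpos : 0 < (M * diagonal c).det := by
    refine det_pos_of_sum_row_lt_diag fun k => ?_
    have hoff : ∑ j ∈ Finset.univ.erase k, |(M * diagonal c) k j| =
        -∑ j ∈ Finset.univ.erase k, M k j * c j := by
      rw [← Finset.sum_neg_distrib]
      refine Finset.sum_congr rfl fun j hj => ?_
      rw [mul_diagonal, abs_of_nonpos (mul_nonpos_of_nonpos_of_nonneg
        (hM k j (Finset.ne_of_mem_erase hj).symm) (hc j))]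
    have hrow : 0 < M k k * c k + ∑ j ∈ Finset.univ.erase k, M k j * c j := by
      rw [Finset.add_sum_erase _ (fun j => M k j * c j) (Finset.mem_univ k)]
      exact hMc k
    rw [hoff, mul_diagonal]
    linarith
  rw [det_mul, det_diagonal] at hpos
  exact pos_of_mul_pos_left hpos (Finset.prod_nonneg fun i _ => hc i)

theorem index_range_mulVecLin {T : Matrix n n ℤ} (hT : T.det ≠ 0) :
    (LinearMap.range T.mulVecLin).toAddSubgroup.index = T.det.natAbs := by
  let e := LinearEquiv.ofInjective T.mulVecLin (mulVec_injective_of_det_ne_zero hT)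
  have hcomp : (LinearMap.range T.mulVecLin).subtype ∘ₗ
      AddMonoidHom.toIntLinearMap (e : (n → ℤ) →+ LinearMap.range T.mulVecLin) = toLin' T := by
    ext
    rfl
  rw [← LinearMap.det_toLin', ← hcomp]
  exact (Submodule.natAbs_det_equiv _ e).symm

end Determinants

theorem injective_of_injective_comp_of_index_ne_zero {G H K : Type*} [AddGroup G]
    [AddCommGroup H] [IsAddTorsionFree H] [AddGroup K] {f : G →+ H} {g : H →+ K}
    (hgf : Function.Injective (g.comp f)) (hf : f.range.index ≠ 0) : Function.Injective g := by
  refine (injective_iff_map_eq_zero g).2 fun h hgh => ?_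
  obtain ⟨x, hx⟩ : f.range.index • h ∈ f.range := f.range.nsmul_index_mem h
  have hx_zero : x = 0 := by
    refine (injective_iff_map_eq_zero (g.comp f)).1 hgf x ?_
    rw [AddMonoidHom.comp_apply, hx, map_nsmul, hgh, nsmul_zero]
  rw [hx_zero, map_zero] at hx
  exact (nsmul_eq_zero_iff_right hf).1 hx.symm

/-! ### Irreducible actions of commutative monoids -/

namespace EndAction

variable {X : Type*} [Finite X] {M : Submonoid (Function.End X)}

theorem minIdem_smul_mem_recurrentSet (hc : ∀ f ∈ M, ∀ g ∈ M, f * g = g * f) (x : X) :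
    minIdem M • x ∈ recurrentSet M := by
  change minIdem M • minIdem M • x = minIdem M • x
  rw [← mul_smul, (minIdem_spec hc).1]

theorem IsIrreducible.exists_smul_eq (h : IsIrreducible M)
    (hc : ∀ f ∈ M, ∀ g ∈ M, f * g = g * f) (x : X) {y : X} (hy : y ∈ recurrentSet M) :
    ∃ m ∈ M, m • x = y := by
  obtain ⟨m, hm, m', hm', hxy⟩ := h.2 x y
  obtain ⟨n, hn, hnm'⟩ := (minIdem_spec hc).2 m' hm'
  refine ⟨n * m, M.mul_mem hn hm, ?_⟩
  rw [mul_smul, hxy, ← mul_smul, hnm']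
  exact hy

theorem IsIrreducible.smul_eq_smul_of_mem_recurrentSet (h : IsIrreducible M)
    (hc : ∀ f ∈ M, ∀ g ∈ M, f * g = g * f) {m m' : Function.End X} (hm : m ∈ M) (hm' : m' ∈ M)
    {x y : X} (hx : m • x = m' • x) (hy : y ∈ recurrentSet M) : m • y = m' • y := by
  obtain ⟨n, hn, rfl⟩ := h.exists_smul_eq hc x hy
  rw [← mul_smul, ← mul_smul, hc m hm n hn, hc m' hm' n hn, mul_smul, mul_smul, hx]

theorem IsIrreducible.ncard_recurrentSet (h : IsIrreducible M)
    (hc : ∀ f ∈ M, ∀ g ∈ M, f * g = g * f) :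
    (recurrentSet M).ncard = (minIdeal M).ncard := by
  obtain ⟨x⟩ := h.1
  refine (Set.ncard_congr (fun g _ => g • x) ?_ ?_ ?_).symm
  · rintro _ ⟨m, -, rfl⟩
    exact minIdem_smul_mem_recurrentSet hc (m • x)
  · rintro _ _ ⟨m, hm, rfl⟩ ⟨m', hm', rfl⟩ hx
    have h_absorb : ∀ k ∈ M, ∀ y : X, (minIdem M * k) • minIdem M • y = (minIdem M * k) • y := by
      intro k hk y
      rw [← mul_smul, mul_assoc, hc k hk _ minIdem_mem, ← mul_assoc, (minIdem_spec hc).1]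
    funext y
    have hy := h.smul_eq_smul_of_mem_recurrentSet hc (M.mul_mem minIdem_mem hm)
      (M.mul_mem minIdem_mem hm') hx (minIdem_smul_mem_recurrentSet hc y)
    rwa [h_absorb m hm, h_absorb m' hm'] at hy
  · intro y hy
    obtain ⟨m, hm, rfl⟩ := h.exists_smul_eq hc x hy
    exact ⟨minIdem M * m, ⟨m, hm, rfl⟩, (mul_smul _ m x).trans hy⟩

end EndAction

namespace AbelianProcessor

open EndAction

variable {I Q U : Type*} {B : U → Type*} (p : AbelianProcessor I Q B)

theorem pairwise_commute_powersHom : Pairwise fun a b => ∀ m n : Multiplicative ℕ,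
    Commute (powersHom (Function.End Q) (p.t a) m) (powersHom (Function.End Q) (p.t b) n) :=
  fun a b _ m n => Commute.pow_pow (p.t_comm a b) m.toAdd n.toAdd

variable [Fintype I]

/-- The action of `ℕ^I` on the state space in which the basis vector `1_a` acts by `t_a`. -/
noncomputable def act (x : I → ℕ) : Function.End Q :=
  MonoidHom.noncommPiCoprod (fun a => powersHom (Function.End Q) (p.t a))
    p.pairwise_commute_powersHom fun a => Multiplicative.ofAdd (x a)

theorem act_zero : p.act 0 = 1 := map_one _

theorem act_add (x y : I → ℕ) : p.act (x + y) = p.act x * p.act y := map_mul _ _ _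

theorem act_single_one [DecidableEq I] (a : I) : p.act (Pi.single a 1) = p.t a := by
  have h_single : (fun b => Multiplicative.ofAdd ((Pi.single a 1 : I → ℕ) b)) =
      Pi.mulSingle a (Multiplicative.ofAdd 1) := rfl
  rw [act, h_single, MonoidHom.noncommPiCoprod_mulSingle, powersHom_apply, toAdd_ofAdd, pow_one]

theorem exists_act_eq {m : Function.End Q} (hm : m ∈ p.monoid) : ∃ x, p.act x = m := by
  classical
  induction hm using Submonoid.closure_induction with
  | mem m hm =>
    obtain ⟨a, rfl⟩ := hm
    exact ⟨Pi.single a 1, p.act_single_one a⟩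
  | one => exact ⟨0, p.act_zero⟩
  | mul m m' _ _ hm hm' =>
    obtain ⟨x, rfl⟩ := hm
    obtain ⟨y, rfl⟩ := hm'
    exact ⟨x + y, p.act_add x y⟩

theorem act_mem (x : I → ℕ) : p.act x ∈ p.monoid := by
  classical
  induction x using natVec_induction with
  | zero => exact p.act_zero ▸ one_mem _
  | add_single x a hx =>
    rw [act_add, act_single_one]
    exact mul_mem hx (p.t_mem a)

variable [Finite Q]

theorem intAction_single_one [DecidableEq I] (a : I) :
    p.intAction (Pi.single a 1) = Additive.ofMul (p.perm a) :=
  (AddMonoidHom.noncommPiCoprod_single _ a 1).trans (one_zsmul _)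

theorem intAction_castVec (x : I → ℕ) (q : recurrentSet p.monoid) :
    ((p.intAction (castVec x)).toMul q : Q) = p.act x • (q : Q) := by
  classical
  induction x using natVec_induction generalizing q with
  | zero =>
    rw [map_zero, map_zero, act_zero, one_smul]
    rfl
  | add_single x a ih =>
    rw [map_add, castVec_single, Nat.cast_one, map_add, intAction_single_one, toMul_add,
      Equiv.Perm.mul_apply, ih, act_add, act_single_one, mul_smul]
    rfl

theorem castVec_sub_mem_kernel_iff {x y : I → ℕ} :
    castVec x - castVec y ∈ p.kernel ↔
      ∀ q ∈ recurrentSet p.monoid, p.act x • q = p.act y • q := by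
  rw [kernel, AddMonoidHom.mem_ker, map_sub, sub_eq_zero, ← Additive.toMul.injective.eq_iff,
    Equiv.ext_iff, Subtype.forall]
  refine forall₂_congr fun q hq => ?_
  rw [← p.intAction_castVec x ⟨q, hq⟩, ← p.intAction_castVec y ⟨q, hq⟩, Subtype.ext_iff]

variable {p}

theorem castVec_sub_mem_kernel_of_smul_eq (h : IsIrreducible p.monoid) {x y : I → ℕ} {q : Q}
    (hxy : p.act x • q = p.act y • q) : castVec x - castVec y ∈ p.kernel :=
  p.castVec_sub_mem_kernel_iff.2 fun _ hq =>
    h.smul_eq_smul_of_mem_recurrentSet p.monoid_comm (p.act_mem x) (p.act_mem y) hxy hq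

theorem castVec_sub_mem_kernel_iff_smul_eq (h : IsIrreducible p.monoid) {x y : I → ℕ} {q : Q}
    (hq : q ∈ recurrentSet p.monoid) :
    castVec x - castVec y ∈ p.kernel ↔ p.act x • q = p.act y • q :=
  ⟨fun hxy => p.castVec_sub_mem_kernel_iff.1 hxy q hq, castVec_sub_mem_kernel_of_smul_eq h⟩

theorem index_kernel (h : IsIrreducible p.monoid) :
    p.kernel.index = (recurrentSet p.monoid).ncard := by
  obtain ⟨q⟩ := h.1
  let q₀ : recurrentSet p.monoid :=
    ⟨minIdem p.monoid • q, minIdem_smul_mem_recurrentSet p.monoid_comm q⟩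
  have h_trans : ∀ q', ∃ x, (p.intAction x).toMul q₀ = q' := by
    intro q'
    obtain ⟨m, hm, hmq⟩ := h.exists_smul_eq p.monoid_comm (q₀ : Q) q'.2
    obtain ⟨x, rfl⟩ := p.exists_act_eq hm
    exact ⟨castVec x, Subtype.ext ((p.intAction_castVec x q₀).trans hmq)⟩
  have h_comm : ∀ x y q', (p.intAction x).toMul ((p.intAction y).toMul q') =
      (p.intAction y).toMul ((p.intAction x).toMul q') := by
    intro x y q'
    rw [← Equiv.Perm.mul_apply, ← toMul_add, ← map_add, add_comm, map_add, toMul_add,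
      Equiv.Perm.mul_apply]
  rw [kernel, AddSubgroup.index_ker, ← Nat.card_coe_set_eq]
  refine Nat.card_congr (Equiv.ofBijective (fun g => g.1.toMul q₀) ⟨?_, fun q' => ?_⟩)
  · rintro ⟨_, x, rfl⟩ ⟨_, y, rfl⟩ (hxy : (p.intAction x).toMul q₀ = (p.intAction y).toMul q₀)
    refine Subtype.ext (Additive.toMul.injective (Equiv.ext fun q' => ?_))
    obtain ⟨z, rfl⟩ := h_trans q'
    rw [h_comm, hxy, h_comm]
  · obtain ⟨x, hx⟩ := h_trans q'
    exact ⟨⟨_, x, rfl⟩, hx⟩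

end AbelianProcessor

/-! ### The global action of an abelian network -/

namespace AbelianNetwork

open EndAction

variable {V : Type*} {G : Digraph V} {A Q : V → Type*}

theorem input_add (x y : Letter A → ℕ) (q : (v : V) → Q v) :
    input (x + y) q = (castVec x + castVec y, q) :=
  Prod.ext (map_add castVec x y) rfl

variable [∀ v, DecidableEq (A v)] (N : AbelianNetwork G A Q)

theorem sent_congr (a b : Letter A) {q q' : (v : V) → Q v} (h : q a.1 = q' a.1) :
    N.sent a q b = N.sent a q' b := by
  simp only [sent, h]

variable [DecidableEq V]

theorem sent_add_sent_update (v : V) (a b : A v) (q : (v : V) → Q v) (d : Letter A) :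
    N.sent ⟨v, a⟩ q d + N.sent ⟨v, b⟩ (Function.update q v ((N.proc v).t a • q v)) d =
      N.sent ⟨v, b⟩ q d + N.sent ⟨v, a⟩ (Function.update q v ((N.proc v).t b • q v)) d := by
  by_cases h : G.Adj v d.1
  · have h_count :=
      ((N.proc v).o_perm (q v) [a, b] [b, a] (List.Perm.swap _ _ _) ⟨d.1, h⟩).count_eq d.2
    simpa [outputWord, sent, h] using h_count
  · simp [sent, h]

theorem step_comm (c : Config A Q) (a b : Letter A) :
    N.step (N.step c a) b = N.step (N.step c b) a := by
  obtain ⟨v, a⟩ := a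
  obtain ⟨u, b⟩ := b
  rcases eq_or_ne u v with rfl | h
  · refine Prod.ext (funext fun d => ?_) ?_
    · have h_sent := N.sent_add_sent_update u a b c.2 d
      simp only [step]
      zify at h_sent
      linarith
    · simp only [step, Function.update_self, Function.update_idem]
      rw [← mul_smul, ← mul_smul, (N.proc u).t_comm]
  · refine Prod.ext (funext fun d => ?_) ?_
    · simp only [step]
      rw [N.sent_congr ⟨u, b⟩ d (Function.update_of_ne h _ c.2),
        N.sent_congr ⟨v, a⟩ d (Function.update_of_ne h.symm _ c.2)]
      ring
    · simp only [step, Function.update_of_ne h, Function.update_of_ne h.symm]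
      exact Function.update_comm h.symm _ _ _

theorem exec_cons (a : Letter A) (w : List (Letter A)) (c : Config A Q) :
    N.exec (a :: w) c = N.exec w (N.step c a) := rfl

theorem exec_append (w w' : List (Letter A)) (c : Config A Q) :
    N.exec (w ++ w') c = N.exec w' (N.exec w c) := List.foldl_append

theorem exec_perm {w w' : List (Letter A)} (h : w.Perm w') (c : Config A Q) :
    N.exec w c = N.exec w' c :=
  h.foldl_eq' (fun a _ b _ c => N.step_comm c a b) c

theorem step_add_left (x y : Letter A → ℤ) (q : (v : V) → Q v) (a : Letter A) :
    N.step (x + y, q) a = (x + (N.step (y, q) a).1, (N.step (y, q) a).2) := by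
  refine Prod.ext (funext fun d => ?_) rfl
  simp only [step, Pi.add_apply]
  ring

theorem exec_add_left (w : List (Letter A)) (x y : Letter A → ℤ) (q : (v : V) → Q v) :
    N.exec w (x + y, q) = (x + (N.exec w (y, q)).1, (N.exec w (y, q)).2) := by
  induction w generalizing y q with
  | nil => rfl
  | cons a w ih => rw [exec_cons, step_add_left, ih, exec_cons]

theorem le_exec_of_notMem {w : List (Letter A)} {b : Letter A} (hb : b ∉ w) (c : Config A Q) :
    c.1 b ≤ (N.exec w c).1 b := by
  induction w generalizing c with
  | nil => rfl
  | cons a w ih =>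
    rw [List.mem_cons, not_or] at hb
    refine le_trans ?_ (ih hb.2 (N.step c a))
    simp only [step, if_neg hb.1]
    omega

theorem legal_append (w w' : List (Letter A)) (c : Config A Q) :
    N.Legal (w ++ w') c ↔ N.Legal w c ∧ N.Legal w' (N.exec w c) := by
  induction w generalizing c with
  | nil => exact (iff_of_eq (true_and _)).symm
  | cons a w ih => rw [List.cons_append, Legal, ih, Legal, exec_cons, and_assoc]

theorem legal_of_count_le {w : List (Letter A)} {c : Config A Q}
    (h : ∀ a, (w.count a : ℤ) ≤ c.1 a) : N.Legal w c := by
  induction w generalizing c with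
  | nil => trivial
  | cons a w ih =>
    refine ⟨?_, ih fun b => ?_⟩
    · have ha := h a
      rw [List.count_cons_self] at ha
      omega
    · have hb := h b
      rw [List.count_cons] at hb
      simp only [step]
      grind

variable {N}

theorem Legal.add_left {w : List (Letter A)} {y : Letter A → ℤ} {q : (v : V) → Q v}
    (h : N.Legal w (y, q)) {x : Letter A → ℤ} (hx : 0 ≤ x) : N.Legal w (x + y, q) := by
  induction w generalizing y q with
  | nil => trivial
  | cons a w ih =>
    refine ⟨le_add_of_nonneg_of_le (hx a) h.1, ?_⟩
    rw [step_add_left]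
    exact ih h.2

theorem Legal.exec_nonneg {w : List (Letter A)} {c : Config A Q} (h : N.Legal w c)
    (hc : 0 ≤ c.1) : 0 ≤ (N.exec w c).1 := by
  induction w generalizing c with
  | nil => exact hc
  | cons a w ih =>
    refine ih h.2 fun b => ?_
    have ha := h.1
    have hb : 0 ≤ c.1 b := hc b
    change 0 ≤ c.1 b - (if b = a then 1 else 0) + (N.sent a c.2 b : ℤ)
    grind

theorem Legal.subperm {w w' : List (Letter A)} {c : Config A Q} (h : N.Legal w c)
    (h' : N.Complete w' c) : w.Subperm w' := by
  induction w generalizing c w' with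
  | nil => exact List.nil_subperm
  | cons a w ih =>
    have h_mem : a ∈ w' := by
      by_contra h_notMem
      exact absurd (h.1.trans ((N.le_exec_of_notMem h_notMem c).trans (h' a))) (by norm_num)
    have h_perm := List.perm_cons_erase h_mem
    refine List.Subperm.trans ?_ h_perm.symm.subperm
    refine (List.subperm_cons a).2 (ih h.2 fun b => ?_)
    rw [← exec_cons, ← N.exec_perm h_perm]
    exact h' b

theorem Legal.perm {w w' : List (Letter A)} {c : Config A Q} (h : N.Legal w c)
    (hc : N.Complete w c) (h' : N.Legal w' c) (hc' : N.Complete w' c) : w.Perm w' :=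
  (h.subperm hc').antisymm (h'.subperm hc)

theorem Legal.globalAct_eq {w : List (Letter A)} {x : Letter A → ℕ} {q : (v : V) → Q v}
    (h : N.Legal w (input x q)) (hc : N.Complete w (input x q)) :
    N.globalAct x q = (N.exec w (input x q)).2 := by
  have h_halts : N.HaltsOn (input x q) := ⟨w, h, hc⟩
  obtain ⟨h', hc'⟩ := h_halts.choose_spec
  rw [globalAct, dif_pos h_halts, N.exec_perm (h'.perm hc' h hc)]

theorem globalAct_zero (q : (v : V) → Q v) : N.globalAct 0 q = q :=
  Legal.globalAct_eq (w := []) trivial fun _ => le_rfl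

theorem exists_legal_exec_eq (hhalt : N.HaltsOnAllInputs) (x : Letter A → ℕ)
    (q : (v : V) → Q v) :
    ∃ w, N.Legal w (input x q) ∧ N.exec w (input x q) = input 0 (N.globalAct x q) := by
  obtain ⟨w, h, hc⟩ := hhalt x q
  exact ⟨w, h, Prod.ext (le_antisymm hc (h.exec_nonneg (castVec_nonneg x)))
    (h.globalAct_eq hc).symm⟩

theorem Legal.globalAct_eq_of_exec_eq (hhalt : N.HaltsOnAllInputs) {w : List (Letter A)}
    {x y : Letter A → ℕ} {q q' : (v : V) → Q v} (h : N.Legal w (input x q))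
    (hw : N.exec w (input x q) = input y q') : N.globalAct x q = N.globalAct y q' := by
  obtain ⟨w', h', hc'⟩ := hhalt y q'
  rw [h'.globalAct_eq hc', ← hw, ← exec_append]
  refine Legal.globalAct_eq ((N.legal_append w w' _).2 ⟨h, hw ▸ h'⟩) fun a => ?_
  rw [exec_append, hw]
  exact hc' a

theorem globalAct_add (hhalt : N.HaltsOnAllInputs) (x y : Letter A → ℕ) (q : (v : V) → Q v) :
    N.globalAct (x + y) q = N.globalAct x (N.globalAct y q) := by
  obtain ⟨w, h, hw⟩ := exists_legal_exec_eq hhalt y q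
  refine Legal.globalAct_eq_of_exec_eq hhalt (w := w) ?_ ?_
  · rw [input_add]
    exact Legal.add_left h (castVec_nonneg x)
  · rw [input_add, exec_add_left]
    change (castVec x + (N.exec w (input y q)).1, (N.exec w (input y q)).2) = _
    rw [hw]
    exact Prod.ext (add_zero _) rfl

/-- The global action of a halting network, as a processor without output. -/
noncomputable def globalProcessor (hhalt : N.HaltsOnAllInputs) :
    AbelianProcessor (Letter A) ((v : V) → Q v) (fun _ : Empty => Empty) where
  t := N.tau
  o _ u := u.elim
  t_comm a b := by
    funext q
    change N.globalAct _ (N.globalAct _ q) = N.globalAct _ (N.globalAct _ q)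
    rw [← globalAct_add hhalt, ← globalAct_add hhalt, add_comm]
  o_perm _ _ _ _ u := u.elim

variable [Fintype V] [∀ v, Fintype (A v)]

theorem act_globalProcessor (hhalt : N.HaltsOnAllInputs) (x : Letter A → ℕ)
    (q : (v : V) → Q v) : (globalProcessor hhalt).act x • q = N.globalAct x q := by
  induction x using natVec_induction generalizing q with
  | zero => rw [AbelianProcessor.act_zero, one_smul, globalAct_zero]
  | add_single x a ih =>
    rw [AbelianProcessor.act_add, AbelianProcessor.act_single_one, mul_smul, ih,
      globalAct_add hhalt]
    rfl

/-! ### Local executions -/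

variable (N)

/-- The state `x ▷ q` reached from `q` by processing `x a` letters `a` for each `a`. -/
noncomputable def localState (x : Letter A → ℕ) (q : (v : V) → Q v) : (v : V) → Q v :=
  (N.localAct x q).2

/-- The net loss of letters when `x` is processed in state `q`, counted for each type. For `x ∈ K`
and `q` locally recurrent this is `(I - P) x`. -/
noncomputable def netLoss (q : (v : V) → Q v) (x : Letter A → ℕ) : Letter A → ℤ :=
  castVec x - N.production q x

theorem count_wordOf (x : Letter A → ℕ) (a : Letter A) : (wordOf x).count a = x a := by
  rw [wordOf, List.count_flatMap]
  simp [Function.comp_def, List.count_replicate]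

theorem exec_wordOf (x : Letter A → ℕ) (y : Letter A → ℤ) (q : (v : V) → Q v) :
    N.exec (wordOf x) (y, q) = (y - N.netLoss q x, N.localState x q) := by
  have h := N.exec_add_left (wordOf x) (y - castVec x) (castVec x) q
  rw [sub_add_cancel] at h
  rw [h, netLoss, ← sub_add]
  rfl

theorem exec_eq {w : List (Letter A)} {x : Letter A → ℕ} (hw : ∀ a, w.count a = x a)
    (y : Letter A → ℤ) (q : (v : V) → Q v) :
    N.exec w (y, q) = (y - N.netLoss q x, N.localState x q) := by
  rw [← exec_wordOf]
  exact N.exec_perm (List.perm_iff_count.2 fun a => (hw a).trans (count_wordOf x a).symm) _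

theorem netLoss_add_and_localState_add (x y : Letter A → ℕ) (q : (v : V) → Q v) :
    N.netLoss q (x + y) = N.netLoss q x + N.netLoss (N.localState x q) y ∧
      N.localState (x + y) q = N.localState y (N.localState x q) := by
  have hw : ∀ a, (wordOf x ++ wordOf y).count a = (x + y) a := fun a => by
    rw [List.count_append, count_wordOf, count_wordOf, Pi.add_apply]
  have h := N.exec_eq hw 0 q
  rw [exec_append, exec_wordOf, exec_wordOf, Prod.mk.injEq] at h
  exact ⟨neg_injective (by rw [← zero_sub, ← h.1, zero_sub, neg_add']), h.2.symm⟩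

theorem localState_add (x y : Letter A → ℕ) (q : (v : V) → Q v) :
    N.localState (x + y) q = N.localState y (N.localState x q) :=
  (N.netLoss_add_and_localState_add x y q).2

theorem netLoss_add (x y : Letter A → ℕ) (q : (v : V) → Q v) :
    N.netLoss q (x + y) = N.netLoss q x + N.netLoss (N.localState x q) y :=
  (N.netLoss_add_and_localState_add x y q).1

theorem localState_zero (q : (v : V) → Q v) : N.localState 0 q = q :=
  (congrArg Prod.snd (N.exec_eq (w := []) (fun _ => List.count_nil) 0 q)).symm

theorem netLoss_zero (q : (v : V) → Q v) : N.netLoss q 0 = 0 := by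
  have h := N.netLoss_add 0 0 q
  rwa [add_zero, localState_zero, left_eq_add] at h

theorem localState_single_one (a : Letter A) (q : (v : V) → Q v) :
    N.localState (Pi.single a 1) q = Function.update q a.1 ((N.proc a.1).t a.2 • q a.1) := by
  have hw : ∀ b, [a].count b = (Pi.single a 1 : Letter A → ℕ) b := fun b => by
    rw [List.count_singleton, Pi.single_apply]
    exact if_congr (beq_iff_eq.trans eq_comm) rfl rfl
  exact (congrArg Prod.snd (N.exec_eq hw 0 q)).symm

theorem localState_apply (x : Letter A → ℕ) (q : (v : V) → Q v) (v : V) :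
    N.localState x q v = (N.proc v).act (fun a => x ⟨v, a⟩) • q v := by
  induction x using natVec_induction with
  | zero =>
    rw [localState_zero]
    exact (congrFun (N.proc v).act_zero (q v)).symm
  | add_single x a ih =>
    obtain ⟨u, a⟩ := a
    rw [localState_add, localState_single_one]
    rcases eq_or_ne u v with rfl | huv
    · have h_restrict : (fun b => (x + Pi.single ⟨u, a⟩ 1 : Letter A → ℕ) ⟨u, b⟩) =
          Pi.single a 1 + fun b => x ⟨u, b⟩ := by
        funext b
        simp [Pi.single_apply, add_comm]
      rw [Function.update_self, ih, h_restrict, AbelianProcessor.act_add,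
        AbelianProcessor.act_single_one, mul_smul]
    · have h_restrict : (fun b => (x + Pi.single ⟨u, a⟩ 1 : Letter A → ℕ) ⟨v, b⟩) =
          fun b => x ⟨v, b⟩ := by
        funext b
        simp [huv.symm]
      rw [Function.update_of_ne huv.symm, ih, h_restrict]

theorem legal_wordOf (x : Letter A → ℕ) (q : (v : V) → Q v) :
    N.Legal (wordOf x) (input x q) :=
  N.legal_of_count_le fun a => (congrArg Nat.cast (count_wordOf x a)).le

theorem production_nonneg (q : (v : V) → Q v) (x : Letter A → ℕ) : 0 ≤ N.production q x :=
  (N.legal_wordOf x q).exec_nonneg (castVec_nonneg x)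

theorem netLoss_le (q : (v : V) → Q v) (x : Letter A → ℕ) : N.netLoss q x ≤ castVec x :=
  sub_le_self _ (N.production_nonneg q x)

variable {N}

theorem exists_odometer (hhalt : N.HaltsOnAllInputs) (x : Letter A → ℕ) (q : (v : V) → Q v) :
    ∃ y, N.netLoss q y = castVec x ∧ N.localState y q = N.globalAct x q := by
  obtain ⟨w, -, hw⟩ := exists_legal_exec_eq hhalt x q
  rw [input, exec_eq N (fun a => rfl)] at hw
  refine ⟨_, (sub_eq_zero.1 (congrArg Prod.fst hw)).symm, congrArg Prod.snd hw⟩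

theorem globalAct_eq_of_localState_eq (hhalt : N.HaltsOnAllInputs) {x x' : Letter A → ℕ}
    {q q' : (v : V) → Q v} (h : N.localState x q = N.localState x' q') :
    N.globalAct (natPart (N.production q' x') + x) q =
      N.globalAct (natPart (N.production q x) + x') q' := by
  have h_local : ∀ (z x : Letter A → ℕ) (q : (v : V) → Q v), N.globalAct (z + x) q =
      N.globalAct (z + natPart (N.production q x)) (N.localState x q) := by
    intro z x q
    refine Legal.globalAct_eq_of_exec_eq hhalt (w := wordOf x) ?_ ?_
    · rw [input_add]
      exact (N.legal_wordOf x q).add_left (castVec_nonneg z)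
    · rw [input_add, exec_wordOf, input_add, castVec_natPart (N.production_nonneg q x), netLoss,
        ← sub_add, add_sub_cancel_right]
  rw [h_local _ x, h_local _ x', h, add_comm]

theorem isIrreducible_globalProcessor (hirr : N.IsIrreducible) (hhalt : N.HaltsOnAllInputs) :
    EndAction.IsIrreducible (globalProcessor hhalt).monoid := by
  refine ⟨⟨fun v => (hirr v).1.some⟩, fun q q' => ?_⟩
  have h_local : ∀ v, ∃ x x', (N.proc v).act x • q v = (N.proc v).act x' • q' v := by
    intro v
    obtain ⟨m, hm, m', hm', h⟩ := (hirr v).2 (q v) (q' v)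
    obtain ⟨x, rfl⟩ := (N.proc v).exists_act_eq hm
    obtain ⟨x', rfl⟩ := (N.proc v).exists_act_eq hm'
    exact ⟨x, x', h⟩
  choose x x' hx using h_local
  have h_state : N.localState (fun a => x a.1 a.2) q = N.localState (fun a => x' a.1 a.2) q' := by
    funext v
    rw [localState_apply, localState_apply]
    exact hx v
  have h_global := globalAct_eq_of_localState_eq hhalt h_state
  rw [← act_globalProcessor hhalt, ← act_globalProcessor hhalt] at h_global
  exact ⟨_, AbelianProcessor.act_mem _ _, _, AbelianProcessor.act_mem _ _, h_global⟩

/-! ### The production map on the total kernel -/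

variable {q : (v : V) → Q v}

theorem localState_add_congr {x y x' y' : Letter A → ℕ}
    (h : N.localState x q = N.localState y q) (h' : N.localState x' q = N.localState y' q) :
    N.localState (x + x') q = N.localState (y + y') q := by
  rw [localState_add, h, ← localState_add, add_comm, localState_add, h', ← localState_add,
    add_comm]

theorem netLoss_add_sub_netLoss_add {x y x' y' : Letter A → ℕ}
    (h : N.localState x q = N.localState y q) (h' : N.localState x' q = N.localState y' q) :
    N.netLoss q (x + x') - N.netLoss q (y + y') =
      (N.netLoss q x - N.netLoss q y) + (N.netLoss q x' - N.netLoss q y') := by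
  have h_left : N.netLoss q (x + x') - N.netLoss q (y + x') = N.netLoss q x - N.netLoss q y := by
    rw [netLoss_add, netLoss_add, h, add_sub_add_right_eq_sub]
  have h_right : N.netLoss q (x' + y) - N.netLoss q (y' + y) =
      N.netLoss q x' - N.netLoss q y' := by
    rw [netLoss_add, netLoss_add, h', add_sub_add_right_eq_sub]
  rw [← h_left, ← h_right, add_comm x' y, add_comm y' y, sub_add_sub_cancel]

theorem netLoss_sub_eq_netLoss_sub {x y x' y' : Letter A → ℕ}
    (h : N.localState x q = N.localState y q) (h' : N.localState x' q = N.localState y' q)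
    (hxy : castVec x - castVec y = castVec x' - castVec y') :
    N.netLoss q x - N.netLoss q y = N.netLoss q x' - N.netLoss q y' := by
  have h_add : x + y' = y + x' := castVec_injective (by
    rw [map_add, map_add, sub_eq_sub_iff_add_eq_add.1 hxy, add_comm])
  have h_sub := netLoss_add_sub_netLoss_add h h'.symm
  rw [h_add, sub_self] at h_sub
  rw [eq_neg_of_add_eq_zero_left h_sub.symm, neg_sub]

variable [∀ v, Finite (Q v)]

theorem castVec_sub_mem_totalKernel_iff (hirr : N.IsIrreducible) (hq : N.IsLocallyRecurrent q)
    {x y : Letter A → ℕ} :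
    castVec x - castVec y ∈ N.totalKernel ↔ N.localState x q = N.localState y q := by
  rw [totalKernel, AddSubgroup.mem_iInf, funext_iff]
  refine forall_congr' fun v => ?_
  rw [localState_apply, localState_apply]
  exact AbelianProcessor.castVec_sub_mem_kernel_iff_smul_eq (hirr v) (hq v)

theorem localState_natPart (hirr : N.IsIrreducible) (hq : N.IsLocallyRecurrent q)
    (k : N.totalKernel) :
    N.localState (natPart (k : Letter A → ℤ)) q = N.localState (natPart (-k : Letter A → ℤ)) q :=
  (castVec_sub_mem_totalKernel_iff hirr hq).1 ((castVec_natPart_sub k.1).symm ▸ k.2)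

/-- The homomorphism `k ↦ (I - P) k` on the total kernel. -/
noncomputable def netLossHom (hirr : N.IsIrreducible) (hq : N.IsLocallyRecurrent q) :
    N.totalKernel →+ (Letter A → ℤ) :=
  AddMonoidHom.mk' (fun k => N.netLoss q (natPart k) - N.netLoss q (natPart (-k))) fun k l => by
    have hk := localState_natPart hirr hq k
    have hl := localState_natPart hirr hq l
    rw [← netLoss_add_sub_netLoss_add hk hl]
    refine netLoss_sub_eq_netLoss_sub (localState_natPart hirr hq (k + l))
      (localState_add_congr hk hl) ?_
    rw [map_add, map_add, add_sub_add_comm, castVec_natPart_sub, castVec_natPart_sub,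
      castVec_natPart_sub, AddSubgroup.coe_add]

theorem netLossHom_apply (hirr : N.IsIrreducible) (hq : N.IsLocallyRecurrent q)
    {x y : Letter A → ℕ} {k : N.totalKernel} (hk : castVec x - castVec y = k) :
    netLossHom hirr hq k = N.netLoss q x - N.netLoss q y :=
  netLoss_sub_eq_netLoss_sub (localState_natPart hirr hq k)
    ((castVec_sub_mem_totalKernel_iff hirr hq).1 (hk ▸ k.2))
    ((castVec_natPart_sub k.1).trans hk.symm)

variable (N) in
theorem rectLattice_le_totalKernel : N.rectLattice ≤ N.totalKernel := by
  rintro _ ⟨c, rfl⟩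
  have h_sum : Matrix.mulVecLin (Matrix.diagonal fun a : Letter A => (N.resetNumber a : ℤ)) c =
      ∑ a, c a • (Pi.single a (N.resetNumber a : ℤ) : Letter A → ℤ) := by
    simp only [← Pi.single_smul, Finset.univ_sum_single]
    funext a
    rw [Matrix.mulVecLin_apply, Matrix.mulVec_diagonal, smul_eq_mul, mul_comm]
  exact h_sum ▸ sum_mem fun a _ => zsmul_mem (N.resetNumber_spec a).2 (c a)

variable (N) in
/-- The homomorphism `D : ℤ^A → K`. -/
noncomputable def resetHom : (Letter A → ℤ) →+ N.totalKernel :=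
  AddMonoidHom.codRestrict
    (Matrix.mulVecLin (Matrix.diagonal fun a => (N.resetNumber a : ℤ))).toAddMonoidHom
    N.totalKernel fun c => N.rectLattice_le_totalKernel ⟨c, rfl⟩

variable (N) in
theorem coe_resetHom_apply (c : Letter A → ℤ) (a : Letter A) :
    (N.resetHom c : Letter A → ℤ) a = N.resetNumber a * c a :=
  Matrix.mulVec_diagonal _ _ _

variable (N) in
theorem index_range_resetHom : N.resetHom.range.index = N.iota := by
  have h_range : N.resetHom.range = N.rectLattice.addSubgroupOf N.totalKernel :=
    AddSubgroup.ext fun k => exists_congr fun c => Subtype.ext_iff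
  rw [h_range]
  rfl

variable (N) in
theorem iota_ne_zero : N.iota ≠ 0 := by
  have h_det : (Matrix.diagonal fun a : Letter A => (N.resetNumber a : ℤ)).det ≠ 0 := by
    rw [Matrix.det_diagonal]
    refine Finset.prod_ne_zero_iff.2 fun a _ => ?_
    exact Nat.cast_ne_zero.2 (Nat.one_le_iff_ne_zero.1 (N.resetNumber_spec a).1)
  refine ne_zero_of_dvd_ne_zero ?_
    (AddSubgroup.relIndex_dvd_index_of_le N.rectLattice_le_totalKernel)
  rw [rectLattice, index_range_mulVecLin h_det]
  exact Int.natAbs_ne_zero.2 h_det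

variable (N) in
/-- The Laplacian `(I - P) D` as a matrix over `ℤ`, whose column `a` is `r_a 1_a - P (r_a 1_a)`. -/
noncomputable def intLaplacian (q : (v : V) → Q v) : Matrix (Letter A) (Letter A) ℤ :=
  Matrix.of fun b a => N.netLoss q (Pi.single a (N.resetNumber a)) b

theorem laplacian_eq_map_intLaplacian :
    N.laplacian q = (N.intLaplacian q).map (Int.castRingHom ℚ) := by
  ext b a
  have hr : (N.resetNumber a : ℚ) ≠ 0 :=
    Nat.cast_ne_zero.2 (Nat.one_le_iff_ne_zero.1 (N.resetNumber_spec a).1)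
  simp only [laplacian, Matrix.mul_diagonal, Matrix.sub_apply, Matrix.one_apply, productionMatrix,
    intLaplacian, netLoss, Matrix.map_apply, Matrix.of_apply, Pi.sub_apply, castVec_apply,
    Pi.single_apply, eq_intCast, Int.cast_sub, Int.cast_natCast, Nat.cast_ite, Nat.cast_zero,
    Int.cast_ite, Int.cast_zero]
  rw [sub_mul, ite_mul, one_mul, zero_mul, mul_right_comm, one_div_mul_cancel hr, one_mul]

theorem netLossHom_comp_resetHom (hirr : N.IsIrreducible) (hq : N.IsLocallyRecurrent q) :
    (netLossHom hirr hq).comp N.resetHom = (N.intLaplacian q).mulVecLin.toAddMonoidHom := by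
  refine AddMonoidHom.functions_ext' _ _ _ fun a => AddMonoidHom.ext_int ?_
  have h_reset : castVec (Pi.single a (N.resetNumber a)) - castVec 0 =
      (N.resetHom (Pi.single a 1) : Letter A → ℤ) := by
    funext b
    rw [coe_resetHom_apply, map_zero, sub_zero, castVec_single]
    rcases eq_or_ne b a with rfl | hba <;> simp [*]
  refine (netLossHom_apply hirr hq h_reset).trans ?_
  rw [netLoss_zero, sub_zero]
  exact (Matrix.mulVec_single_one (N.intLaplacian q) a).symm

theorem mulVec_intLaplacian (hirr : N.IsIrreducible) (hq : N.IsLocallyRecurrent q)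
    {x y : Letter A → ℕ} {c : Letter A → ℤ}
    (hc : ∀ a, (x a : ℤ) = N.resetNumber a * c a + y a) :
    Matrix.mulVec (N.intLaplacian q) c = N.netLoss q x - N.netLoss q y := by
  rw [← netLossHom_apply hirr hq (k := N.resetHom c)]
  · exact (DFunLike.congr_fun (netLossHom_comp_resetHom hirr hq) c).symm
  · funext a
    rw [coe_resetHom_apply, Pi.sub_apply, castVec_apply, castVec_apply, hc, add_sub_cancel_right]

theorem det_intLaplacian_pos (hirr : N.IsIrreducible) (hhalt : N.HaltsOnAllInputs)
    (hq : N.IsLocallyRecurrent q) : 0 < (N.intLaplacian q).det := by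
  obtain ⟨x, hx, -⟩ := exists_odometer hhalt N.resetNumber q
  have hc : ∀ a, 0 < Matrix.mulVec (N.intLaplacian q) (fun a => (x a / N.resetNumber a : ℕ)) a := by
    intro a
    rw [mulVec_intLaplacian hirr hq (x := x) (y := fun a => x a % N.resetNumber a)
      fun a => mod_cast (Nat.div_add_mod (x a) (N.resetNumber a)).symm, hx]
    have h_le := N.netLoss_le q (fun a => x a % N.resetNumber a) a
    have h_lt : x a % N.resetNumber a < N.resetNumber a := Nat.mod_lt _ (N.resetNumber_spec a).1
    simp only [castVec_apply, Pi.sub_apply] at h_le ⊢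
    omega
  have h_pos : 0 < ((N.intLaplacian q).map (Int.castRingHom ℝ)).det := by
    refine det_pos_of_mulVec_pos (c := fun a => ((x a / N.resetNumber a : ℕ) : ℝ)) ?_
      (fun a => Nat.cast_nonneg _) fun a => ?_
    · intro b a hba
      have h_le := N.netLoss_le q (Pi.single a (N.resetNumber a)) b
      rw [castVec_apply, Pi.single_eq_of_ne hba, Nat.cast_zero] at h_le
      exact Int.cast_nonpos.2 h_le
    · have h_cast := (Int.castRingHom ℝ).map_mulVec (N.intLaplacian q)
        (fun a => (x a / N.resetNumber a : ℕ)) a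
      exact (Int.cast_pos.2 (hc a)).trans_eq (h_cast.trans (by
        simp only [Function.comp_def, eq_intCast, Int.cast_natCast]))
  rw [← RingHom.mapMatrix_apply, ← RingHom.map_det] at h_pos
  exact Int.cast_pos.1 h_pos

theorem netLossHom_injective (hirr : N.IsIrreducible) (hhalt : N.HaltsOnAllInputs)
    (hq : N.IsLocallyRecurrent q) : Function.Injective (netLossHom hirr hq) := by
  refine injective_of_injective_comp_of_index_ne_zero (f := N.resetHom) ?_
    (N.index_range_resetHom ▸ N.iota_ne_zero)
  rw [netLossHom_comp_resetHom]
  exact Matrix.mulVec_injective_of_det_ne_zero (det_intLaplacian_pos hirr hhalt hq).ne'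

theorem netLossHom_mem_kernel (hirr : N.IsIrreducible) (hhalt : N.HaltsOnAllInputs)
    (hq : N.IsLocallyRecurrent q) (k : N.totalKernel) :
    netLossHom hirr hq k ∈ (globalProcessor hhalt).kernel := by
  have h_act := globalAct_eq_of_localState_eq hhalt (localState_natPart hirr hq k)
  rw [← act_globalProcessor hhalt, ← act_globalProcessor hhalt] at h_act
  have h_mem := AbelianProcessor.castVec_sub_mem_kernel_of_smul_eq
    (isIrreducible_globalProcessor hirr hhalt) h_act
  rw [map_add, map_add, castVec_natPart (N.production_nonneg _ _),
    castVec_natPart (N.production_nonneg _ _)] at h_mem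
  convert h_mem using 1
  rw [netLossHom_apply hirr hq (castVec_natPart_sub k.1), netLoss, netLoss]
  abel

theorem exists_netLossHom_eq (hirr : N.IsIrreducible) (hhalt : N.HaltsOnAllInputs)
    (hq : N.IsLocallyRecurrent q) {z : Letter A → ℤ} (hz : z ∈ (globalProcessor hhalt).kernel) :
    ∃ k, netLossHom hirr hq k = z := by
  let p := globalProcessor hhalt
  let u := natPart z
  let u' := natPart (-z)
  have hu : castVec u - castVec u' = z := castVec_natPart_sub z
  obtain ⟨e, he⟩ := p.exists_act_eq minIdem_mem
  have h_act : N.globalAct (u + e) q = N.globalAct (u' + e) q := by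
    rw [← act_globalProcessor hhalt, ← act_globalProcessor hhalt, AbelianProcessor.act_add,
      AbelianProcessor.act_add, mul_smul, mul_smul, he]
    exact p.castVec_sub_mem_kernel_iff.1 (hu ▸ hz) _
      (minIdem_smul_mem_recurrentSet p.monoid_comm q)
  obtain ⟨y, hy_loss, hy_state⟩ := exists_odometer hhalt (u + e) q
  obtain ⟨y', hy'_loss, hy'_state⟩ := exists_odometer hhalt (u' + e) q
  have h_mem : castVec y - castVec y' ∈ N.totalKernel :=
    (castVec_sub_mem_totalKernel_iff hirr hq).2 (by rw [hy_state, hy'_state, h_act])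
  refine ⟨⟨_, h_mem⟩, ?_⟩
  rw [netLossHom_apply hirr hq rfl, hy_loss, hy'_loss, map_add, map_add, add_sub_add_right_eq_sub,
    hu]

theorem range_netLossHom (hirr : N.IsIrreducible) (hhalt : N.HaltsOnAllInputs)
    (hq : N.IsLocallyRecurrent q) :
    (netLossHom hirr hq).range = (globalProcessor hhalt).kernel :=
  le_antisymm (by rintro _ ⟨k, rfl⟩; exact netLossHom_mem_kernel hirr hhalt hq k)
    fun _ => exists_netLossHom_eq hirr hhalt hq

theorem iota_mul_index_kernel (hirr : N.IsIrreducible) (hhalt : N.HaltsOnAllInputs)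
    (hq : N.IsLocallyRecurrent q) :
    ((N.iota * (globalProcessor hhalt).kernel.index : ℕ) : ℤ) = (N.intLaplacian q).det := by
  have h_det := det_intLaplacian_pos hirr hhalt hq
  rw [← index_range_resetHom, ← range_netLossHom hirr hhalt hq,
    ← AddSubgroup.index_map_of_injective _ (netLossHom_injective hirr hhalt hq),
    AddMonoidHom.map_range, netLossHom_comp_resetHom]
  exact (congrArg Nat.cast (index_range_mulVecLin h_det.ne')).trans
    (Int.natAbs_of_nonneg h_det.le)

end AbelianNetwork

theorem theorem3p19 {V : Type*} [Fintype V] [DecidableEq V] (G : Digraph V) (A Q : V → Type*)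
    [∀ v, Fintype (A v)] [∀ v, DecidableEq (A v)] [∀ v, Finite (Q v)]
    (N : AbelianNetwork G A Q) (hirr : N.IsIrreducible) (hhalt : N.HaltsOnAllInputs) :
    N.Rec.ncard = N.Crit.ncard ∧
      ∀ q : (v : V) → Q v, N.IsLocallyRecurrent q →
        (N.Crit.ncard : ℚ) = (N.laplacian q).det / (N.iota : ℚ) := by
  have hglobal := AbelianNetwork.isIrreducible_globalProcessor hirr hhalt
  have hrec : N.Rec.ncard = N.Crit.ncard :=
    hglobal.ncard_recurrentSet (AbelianNetwork.globalProcessor hhalt).monoid_comm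
  refine ⟨hrec, fun q hq => ?_⟩
  have hindex : (AbelianNetwork.globalProcessor hhalt).kernel.index = N.Crit.ncard :=
    (AbelianProcessor.index_kernel hglobal).trans hrec
  have hdet : (N.laplacian q).det = ((N.intLaplacian q).det : ℚ) := by
    rw [AbelianNetwork.laplacian_eq_map_intLaplacian, ← RingHom.mapMatrix_apply,
      ← RingHom.map_det, eq_intCast]
  rw [eq_div_iff (Nat.cast_ne_zero.2 N.iota_ne_zero), hdet,
    ← AbelianNetwork.iota_mul_index_kernel hirr hhalt hq, hindex, Int.cast_natCast,
    Nat.cast_mul, mul_comm]
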